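/- Let $\mathcal H$ be a finite-dimensional complex Hilbert space. Let $\widehat P=\{\hat\rho_n\}$, $\widehat\Sigma=\{\hat\sigma_n\}$, $\widehat P'=\{\hat\rho'_n\}$, $\widehat\Sigma'=\{\hat\sigma'_n\}$ be arbitrary sequences of quantum states (positive semidefinite operators of trace one), the $n$-th ones acting on $\mathcal H^{\otimes n}$. Let $D(\hat\rho,\hat\tau)=\frac12\mathrm{tr}|\hat\rho-\hat\tau|$ be the trace distance. For states $\hat\rho,\hat\sigma$ on the same space put $$S_0(\hat\rho\|\hat\sigma)=-\ln\mathrm{tr}[\hat P_{\hat\rho}\hat\sigma],\qquad S_\infty(\hat\rho\|\hat\sigma)=\ln\min\{\lambda\ge 0:\hat\rho\le\lambda\hat\sigma\},$$ where $\hat P_{\hat\rho}$ is the orthogonal projection onto the support of $\hat\rho$; the values lie in $[0,+\infty]$, with $-\ln 0=+\infty$ and $S_\infty=+\infty$ if no such $\lambda$ exists. For $\varepsilon>0$ let $$S_\infty^\varepsilon(\hat\rho\|\hat\sigma)=\min_{\hat\tau}S_\infty(\hat\tau\|\hat\sigma),\qquad S_0^\varepsilon(\hat\rho\|\hat\sigma)=\max_{\hat\tau}S_0(\hat\tau\|\hat\sigma),$$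 both over all states $\hat\tau$ with $D(\hat\tau,\hat\rho)\le\varepsilon$. The upper and lower spectral divergence rates are $$\overline S(\widehat P\|\widehat\Sigma)=\lim_{\varepsilon\to+0}\limsup_{n\to\infty}\tfrac1n S_\infty^\varepsilon(\hat\rho_n\|\hat\sigma_n),\qquad \underline S(\widehat P\|\widehat\Sigma)=\lim_{\varepsilon\to+0}\liminf_{n\to\infty}\tfrac1n S_0^\varepsilon(\hat\rho_n\|\hat\sigma_n)$$ (the limits in $\varepsilon$ exist in $[0,+\infty]$ by monotonicity). Write $(\widehat P',\widehat\Sigma')\prec^{\rm a}(\widehat P,\widehat\Sigma)$ if there are completely positive trace-preserving maps $\mathcal E_n$ on the operators on $\mathcal H^{\otimes n}$ such that $\mathcal E_n(\hat\sigma_n)=\hat\sigma'_n$ for all $n$ and $\lim_{n\to\infty}D(\mathcal E_n(\hat\rho_n),\hat\rho'_n)=0$. Suppose that $\overline S(\widehat P\|\widehat\Sigma)=\underline S(\widehat P\|\widehat\Sigma)=:S(\widehat P\|\widehat\Sigma)$ and $\overline S(\widehat P'\|\widehat\Sigma')=\underline S(\widehat P'\|\widehat\Sigma')=:S(\widehat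 P'\|\widehat\Sigma')$. Then: (a) $(\widehat P',\widehat\Sigma')\prec^{\rm a}(\widehat P,\widehat\Sigma)$ implies $S(\widehat P'\|\widehat\Sigma')\le S(\widehat P\|\widehat\Sigma)$. (b) $S(\widehat P'\|\widehat\Sigma')<S(\widehat P\|\widehat\Sigma)$ implies $(\widehat P',\widehat\Sigma')\prec^{\rm a}(\widehat P,\widehat\Sigma)$. -/

import Mathlib

open Filter Topology
open scoped ComplexOrder MatrixOrder NNReal ENNReal

/-- Quantum states (density operators) on the Hilbert space `ℂ^α`: positive semidefinite
operators of trace one, written as matrices in the standard orthonormal basis. -/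
structure QState (α : Type) [Fintype α] [DecidableEq α] where
  mat : Matrix α α ℂ
  posSemidef : mat.PosSemidef
  trace_eq_one : mat.trace = 1

/-- Index set of the product basis of the `n`-fold tensor power `(ℂ^d)^{⊗ n}`. -/
abbrev TensorIndex (d n : ℕ) : Type := Fin n → Fin d

/-- A sequence of states `ρ_n ∈ S(H^{⊗ n})`, where `H = ℂ^d`. -/
abbrev StateSeq (d : ℕ) : Type := ∀ n : ℕ, QState (TensorIndex d n)

noncomputable section

namespace Quantum

variable {α β : Type} [Fintype α] [DecidableEq α] [Fintype β] [DecidableEq β]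

/-- The ampliation `E ⊗ id_k : L(ℂ^α ⊗ ℂ^k) → L(ℂ^β ⊗ ℂ^k)`: apply `E` to every block. -/
def ampliation (E : Matrix α α ℂ →ₗ[ℂ] Matrix β β ℂ) (k : ℕ)
    (X : Matrix (α × Fin k) (α × Fin k) ℂ) : Matrix (β × Fin k) (β × Fin k) ℂ :=
  Matrix.of fun i j => E (Matrix.of fun a b => X (a, i.2) (b, j.2)) i.1 j.1

/-- Complete positivity: `E ⊗ id_k` is positive for every `k`. -/
def IsCompletelyPositive (E : Matrix α α ℂ →ₗ[ℂ] Matrix β β ℂ) : Prop :=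
  ∀ (k : ℕ) (X : Matrix (α × Fin k) (α × Fin k) ℂ),
    X.PosSemidef → (ampliation E k X).PosSemidef

/-- Completely positive and trace preserving maps. -/
def IsCPTP (E : Matrix α α ℂ →ₗ[ℂ] Matrix β β ℂ) : Prop :=
  IsCompletelyPositive E ∧ ∀ X : Matrix α α ℂ, (E X).trace = X.trace

/-- The trace norm `‖X‖₁ = tr |X|` with `|X| = √(X† X)`. -/
def traceNorm (X : Matrix α α ℂ) : ℝ := (CFC.abs X).trace.re

/-- The trace distance `D(X, Y) = ‖X - Y‖₁ / 2`. -/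
def traceDist (X Y : Matrix α α ℂ) : ℝ := traceNorm (X - Y) / 2

/-- The orthogonal projection onto the support of a Hermitian matrix. The support, the span of
the eigenvectors with nonzero eigenvalue, is the range. -/
def supportProj (X : Matrix α α ℂ) : Matrix α α ℂ :=
  (Matrix.toEuclideanCLM (n := α) (𝕜 := ℂ)).symm
    (LinearMap.range (Matrix.toEuclideanLin X)).starProjection

/-- The Rényi `0`-divergence `S₀(ρ‖σ) = - ln tr[P_ρ σ]`, where `- ln 0 = +∞`. -/
def renyiZero (ρ σ : QState α) : EReal :=
  -ENNReal.log (ENNReal.ofReal (supportProj ρ.mat * σ.mat).trace.re)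

/-- The Rényi `∞`-divergence `S_∞(ρ‖σ) = ln min {c : ρ ≤ c σ}`; it is `+∞` if there is
no such `c`. -/
def renyiInfty (ρ σ : QState α) : EReal :=
  ENNReal.log (⨅ (c : ℝ≥0) (_ : ρ.mat ≤ (c : ℂ) • σ.mat), (c : ℝ≥0∞))

/-- The `ε`-neighbourhood `B^ε(ρ)` of a state, among normalized states. -/
def nbhd (ε : ℝ) (ρ : QState α) : Set (QState α) :=
  {τ | traceDist τ.mat ρ.mat ≤ ε}

/-- The smooth Rényi `∞`-divergence. -/
def smoothRenyiInfty (ε : ℝ) (ρ σ : QState α) : EReal :=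
  ⨅ τ ∈ nbhd ε ρ, renyiInfty τ σ

/-- The smooth Rényi `0`-divergence. -/
def smoothRenyiZero (ε : ℝ) (ρ σ : QState α) : EReal :=
  ⨆ τ ∈ nbhd ε ρ, renyiZero τ σ

/-- `limsup_{n → ∞} S_∞^ε(ρ_n‖σ_n) / n`. -/
def upperRateAt {d : ℕ} (P Sg : StateSeq d) (ε : ℝ) : EReal :=
  limsup (fun n : ℕ => smoothRenyiInfty ε (P n) (Sg n) / (n : EReal)) atTop

/-- `liminf_{n → ∞} S_0^ε(ρ_n‖σ_n) / n`. -/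
def lowerRateAt {d : ℕ} (P Sg : StateSeq d) (ε : ℝ) : EReal :=
  liminf (fun n : ℕ => smoothRenyiZero ε (P n) (Sg n) / (n : EReal)) atTop

/-- The upper spectral divergence rate, the limit as `ε → +0`; this limit always exists, see
`tendsto_upperRateAt`. -/
def upperSpectralRate {d : ℕ} (P Sg : StateSeq d) : EReal :=
  limUnder (𝓝[>] (0 : ℝ)) (upperRateAt P Sg)

/-- The lower spectral divergence rate, the limit as `ε → +0`; this limit always exists, see
`tendsto_lowerRateAt`. -/
def lowerSpectralRate {d : ℕ} (P Sg : StateSeq d) : EReal :=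
  limUnder (𝓝[>] (0 : ℝ)) (lowerRateAt P Sg)

/-- `AsympDMajorizedBy P' Sg' P Sg` is `(P', Sg') ≺ᵃ (P, Sg)`: there are CPTP maps `E_n` with
`D(E_n(ρ_n), ρ'_n) → 0` and `E_n(σ_n) = σ'_n`. -/
def AsympDMajorizedBy {d : ℕ} (P' Sg' P Sg : StateSeq d) : Prop :=
  ∃ E : ∀ n : ℕ, Matrix (TensorIndex d n) (TensorIndex d n) ℂ →ₗ[ℂ]
      Matrix (TensorIndex d n) (TensorIndex d n) ℂ,
    (∀ n, IsCPTP (E n)) ∧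
    Tendsto (fun n => traceDist (E n (P n).mat) (P' n).mat) atTop (𝓝 0) ∧
    ∀ n, E n (Sg n).mat = (Sg' n).mat

theorem nbhd_mono (ρ : QState α) {ε δ : ℝ} (h : ε ≤ δ) : nbhd ε ρ ⊆ nbhd δ ρ :=
  fun _ hτ => le_trans hτ h

theorem antitone_upperRateAt {d : ℕ} (P Sg : StateSeq d) : Antitone (upperRateAt P Sg) :=
  fun _ _ h => limsup_le_limsup (Eventually.of_forall fun _ =>
    EReal.monotone_div_right_of_nonneg (by positivity)
      (biInf_mono (nbhd_mono _ h)))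

theorem monotone_lowerRateAt {d : ℕ} (P Sg : StateSeq d) : Monotone (lowerRateAt P Sg) :=
  fun _ _ h => liminf_le_liminf (Eventually.of_forall fun _ =>
    EReal.monotone_div_right_of_nonneg (by positivity)
      (biSup_mono (nbhd_mono _ h)))

theorem tendsto_upperRateAt {d : ℕ} (P Sg : StateSeq d) :
    Tendsto (upperRateAt P Sg) (𝓝[>] (0 : ℝ)) (𝓝 (upperSpectralRate P Sg)) :=
  tendsto_nhds_limUnder ⟨_, (antitone_upperRateAt P Sg).tendsto_nhdsGT 0⟩

theorem tendsto_lowerRateAt {d : ℕ} (P Sg : StateSeq d) :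
    Tendsto (lowerRateAt P Sg) (𝓝[>] (0 : ℝ)) (𝓝 (lowerSpectralRate P Sg)) :=
  tendsto_nhds_limUnder ⟨_, (monotone_lowerRateAt P Sg).tendsto_nhdsGT 0⟩

end Quantum

end

set_option linter.unusedSectionVars false

namespace Quantum

open Matrix

variable {α β : Type} [Fintype α] [DecidableEq α] [Fintype β] [DecidableEq β]

/-! For (a): a channel preserves `ρ ≤ c σ` and contracts the trace distance, so it carries the
smoothing ball of `ρ_n` into a slightly larger ball around `ρ'_n` without raising `S_∞`
(`smoothRenyiInfty_map_le`). The enlargement vanishes in the limit.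

For (b): if `S_∞(τ'‖σ') < S_0(τ‖σ)`, measure the support projection `Q` of `τ`, preparing `τ'` on
success and a state `ω` on failure. Then `τ` goes to `τ'` exactly, and `σ` goes to `p τ' + (1 - p)
ω` with `p = tr[Q σ]`. The gap gives `p τ' ≤ σ'`, so some `ω` makes this equal `σ'`
(`exists_isCPTP_of_renyiInfty_lt_renyiZero`). Smoothing costs an error `2ε`, and near-optimal
channels for each `n` remove the dependence on `ε`. -/

theorem trace_mul_re_nonneg {A B : Matrix α α ℂ} (hA : A.PosSemidef) (hB : B.PosSemidef) :
    0 ≤ (A * B).trace.re := by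
  obtain ⟨R, rfl⟩ := CStarAlgebra.nonneg_iff_eq_star_mul_self.mp
    (Matrix.nonneg_iff_posSemidef.mpr hA)
  have h := (hB.mul_mul_conjTranspose_same R).trace_nonneg
  rw [Matrix.trace_mul_comm, ← Matrix.mul_assoc] at h
  exact (Complex.le_def.mp h).1

theorem trace_re_nonneg {A : Matrix α α ℂ} (hA : A.PosSemidef) : 0 ≤ A.trace.re :=
  (Complex.le_def.mp hA.trace_nonneg).1

/-! ### Trace norm and trace distance -/

theorem traceNorm_nonneg (X : Matrix α α ℂ) : 0 ≤ traceNorm X :=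
  trace_re_nonneg (Matrix.nonneg_iff_posSemidef.mp (CFC.abs_nonneg X))

theorem traceDist_nonneg (X Y : Matrix α α ℂ) : 0 ≤ traceDist X Y :=
  div_nonneg (traceNorm_nonneg _) zero_le_two

theorem traceDist_comm (X Y : Matrix α α ℂ) : traceDist X Y = traceDist Y X := by
  rw [traceDist, traceDist, traceNorm, traceNorm, ← neg_sub, CFC.abs_neg]

/-- The Jordan decomposition of a Hermitian matrix attains the trace norm. -/
theorem exists_posSemidef_sub_eq {X : Matrix α α ℂ} (hX : X.IsHermitian) :
    ∃ A B : Matrix α α ℂ, A.PosSemidef ∧ B.PosSemidef ∧ X = A - B ∧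
      traceNorm X = A.trace.re + B.trace.re := by
  have hX' : IsSelfAdjoint X := hX
  refine ⟨X⁺, X⁻, Matrix.nonneg_iff_posSemidef.mp (CFC.posPart_nonneg X),
    Matrix.nonneg_iff_posSemidef.mp (CFC.negPart_nonneg X),
    (CFC.posPart_sub_negPart X hX').symm, ?_⟩
  rw [traceNorm, ← CFC.posPart_add_negPart X hX', Matrix.trace_add, Complex.add_re]

/-- The trace norm is at most `tr A + tr B` for every decomposition into a difference of positive
semidefinite matrices. -/
theorem traceNorm_sub_le {A B : Matrix α α ℂ} (hA : A.PosSemidef) (hB : B.PosSemidef) :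
    traceNorm (A - B) ≤ A.trace.re + B.trace.re := by
  have hX : IsSelfAdjoint (A - B) := hA.isHermitian.sub hB.isHermitian
  have hcont : ∀ f : ℝ → ℝ, ContinuousOn f (spectrum ℝ (A - B)) := fun f =>
    (Matrix.finite_real_spectrum (A := A - B)).continuousOn f
  -- The sign `s` of `A - B` satisfies `-1 ≤ s ≤ 1` and `s (A - B) = |A - B|`; testing `1 - s` on
  -- `A` and `1 + s` on `B` gives the bound.
  let s : ℝ → ℝ := fun x => if 0 ≤ x then 1 else -1
  have hmul : cfc s (A - B) * (A - B) = CFC.abs (A - B) := by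
    rw [CFC.abs_eq_cfc_norm (A - B) hX]
    conv_lhs => enter [2]; rw [← cfc_id ℝ (A - B) hX]
    rw [← cfc_mul s id (A - B) (hcont _) (hcont _)]
    refine cfc_congr fun x _ => ?_
    by_cases hx : 0 ≤ x
    · simp [s, hx, abs_of_nonneg hx]
    · simp [s, hx, abs_of_neg (not_le.mp hx)]
  have h1 : (1 - cfc s (A - B)).PosSemidef := by
    rw [← Matrix.le_iff]
    refine cfc_le_one s (A - B) fun x _ => ?_
    by_cases hx : 0 ≤ x <;> simp [s, hx]
  have h2 : (1 + cfc s (A - B)).PosSemidef := by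
    rw [← sub_neg_eq_add, ← Matrix.le_iff, ← cfc_neg]
    refine cfc_le_one _ (A - B) fun x _ => ?_
    by_cases hx : 0 ≤ x <;> simp [s, hx]
  have h3 := trace_mul_re_nonneg h1 hA
  have h4 := trace_mul_re_nonneg h2 hB
  simp only [Matrix.sub_mul, Matrix.add_mul, Matrix.one_mul, Matrix.trace_sub, Matrix.trace_add,
    Complex.sub_re, Complex.add_re] at h3 h4
  rw [traceNorm, ← hmul, Matrix.mul_sub, Matrix.trace_sub, Complex.sub_re]
  linarith

theorem traceNorm_add_le {X Y : Matrix α α ℂ} (hX : X.IsHermitian) (hY : Y.IsHermitian) :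
    traceNorm (X + Y) ≤ traceNorm X + traceNorm Y := by
  obtain ⟨A, B, hA, hB, rfl, h⟩ := exists_posSemidef_sub_eq hX
  obtain ⟨C, D, hC, hD, rfl, h'⟩ := exists_posSemidef_sub_eq hY
  have key := traceNorm_sub_le (hA.add hC) (hB.add hD)
  rw [Matrix.trace_add, Matrix.trace_add, Complex.add_re, Complex.add_re] at key
  rw [h, h', sub_add_sub_comm]
  linarith

theorem traceDist_triangle {X Y Z : Matrix α α ℂ} (hX : X.IsHermitian) (hY : Y.IsHermitian)
    (hZ : Z.IsHermitian) : traceDist X Z ≤ traceDist X Y + traceDist Y Z := by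
  have h := traceNorm_add_le (hX.sub hY) (hY.sub hZ)
  rw [sub_add_sub_cancel] at h
  simp only [traceDist]
  linarith

/-! ### Data processing under channels -/

theorem IsCompletelyPositive.posSemidef {E : Matrix α α ℂ →ₗ[ℂ] Matrix β β ℂ}
    (hE : IsCompletelyPositive E) {X : Matrix α α ℂ} (hX : X.PosSemidef) : (E X).PosSemidef :=
  (hE 1 (X.submatrix Prod.fst Prod.fst) (hX.submatrix Prod.fst)).submatrix fun b => (b, 0)

theorem IsCompletelyPositive.mono {E : Matrix α α ℂ →ₗ[ℂ] Matrix β β ℂ}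
    (hE : IsCompletelyPositive E) {X Y : Matrix α α ℂ} (h : X ≤ Y) : E X ≤ E Y := by
  rw [Matrix.le_iff, ← map_sub]
  exact hE.posSemidef h

/-- The images of the two Jordan parts of `X - Y` are still positive with the same traces, so they
bound the new trace norm. -/
theorem IsCPTP.traceDist_le {E : Matrix α α ℂ →ₗ[ℂ] Matrix β β ℂ} (hE : IsCPTP E)
    {X Y : Matrix α α ℂ} (hX : X.IsHermitian) (hY : Y.IsHermitian) :
    traceDist (E X) (E Y) ≤ traceDist X Y := by
  obtain ⟨A, B, hA, hB, h, hn⟩ := exists_posSemidef_sub_eq (hX.sub hY)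
  have key := traceNorm_sub_le (hE.1.posSemidef hA) (hE.1.posSemidef hB)
  rw [hE.2, hE.2, ← map_sub, ← h, ← hn, map_sub] at key
  simp only [traceDist]
  linarith

/-- The image of a state under a quantum channel. -/
def _root_.QState.map (τ : QState α) {E : Matrix α α ℂ →ₗ[ℂ] Matrix β β ℂ} (hE : IsCPTP E) :
    QState β where
  mat := E τ.mat
  posSemidef := hE.1.posSemidef τ.posSemidef
  trace_eq_one := (hE.2 _).trans τ.trace_eq_one

theorem renyiInfty_map_le {E : Matrix α α ℂ →ₗ[ℂ] Matrix β β ℂ} (hE : IsCPTP E) (τ σ : QState α) :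
    renyiInfty (τ.map hE) (σ.map hE) ≤ renyiInfty τ σ := by
  refine ENNReal.log_monotone (iInf₂_mono' fun c hc => ⟨c, ?_, le_rfl⟩)
  have h := hE.1.mono hc
  rwa [map_smul] at h

theorem smoothRenyiInfty_map_le {E : Matrix α α ℂ →ₗ[ℂ] Matrix β β ℂ} (hE : IsCPTP E)
    (ρ σ : QState α) (ρ' : QState β) {ε δ : ℝ} (h : traceDist (E ρ.mat) ρ'.mat ≤ δ) :
    smoothRenyiInfty (ε + δ) ρ' (σ.map hE) ≤ smoothRenyiInfty ε ρ σ := by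
  refine iInf₂_mono' fun τ hτ => ⟨τ.map hE, ?_, renyiInfty_map_le hE τ σ⟩
  calc traceDist (E τ.mat) ρ'.mat
      ≤ traceDist (E τ.mat) (E ρ.mat) + traceDist (E ρ.mat) ρ'.mat :=
        traceDist_triangle (τ.map hE).posSemidef.isHermitian (ρ.map hE).posSemidef.isHermitian
          ρ'.posSemidef.isHermitian
    _ ≤ ε + δ := add_le_add ((hE.traceDist_le τ.posSemidef.isHermitian
          ρ.posSemidef.isHermitian).trans hτ) h

/-! ### Support projections -/

theorem supportProj_isHermitian (X : Matrix α α ℂ) : (supportProj X).IsHermitian := by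
  have h : IsSelfAdjoint (LinearMap.range (Matrix.toEuclideanLin X)).starProjection :=
    isSelfAdjoint_starProjection _
  exact h.map (Matrix.toEuclideanCLM (n := α) (𝕜 := ℂ)).symm

theorem supportProj_mul_self (X : Matrix α α ℂ) :
    supportProj X * supportProj X = supportProj X := by
  rw [supportProj, ← map_mul]
  congr 1
  exact Submodule.isIdempotentElem_starProjection _

theorem supportProj_mul (X : Matrix α α ℂ) : supportProj X * X = X := by
  refine EquivLike.injective (Matrix.toEuclideanCLM (n := α) (𝕜 := ℂ)) ?_
  rw [map_mul, supportProj, StarAlgEquiv.apply_symm_apply]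
  ext1 v
  refine Submodule.starProjection_eq_self_iff.mpr ⟨v, ?_⟩
  rw [← Matrix.coe_toEuclideanCLM_eq_toEuclideanLin]

theorem posSemidef_of_isHermitian_of_mul_self {Q : Matrix α α ℂ} (hQ : Q.IsHermitian)
    (h : Q * Q = Q) : Q.PosSemidef := by
  have := Matrix.posSemidef_conjTranspose_mul_self Q
  rwa [hQ.eq, h] at this

theorem posSemidef_supportProj (X : Matrix α α ℂ) : (supportProj X).PosSemidef :=
  posSemidef_of_isHermitian_of_mul_self (supportProj_isHermitian X) (supportProj_mul_self X)

theorem posSemidef_one_sub_supportProj (X : Matrix α α ℂ) : (1 - supportProj X).PosSemidef := by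
  refine posSemidef_of_isHermitian_of_mul_self
    (Matrix.isHermitian_one.sub (supportProj_isHermitian X)) ?_
  rw [Matrix.mul_sub, Matrix.sub_mul, Matrix.sub_mul, supportProj_mul_self]
  simp

/-! ### Measure-and-prepare channels -/

/-- The linear map `X ↦ tr[Q X] τ`. -/
def measurePrepare (Q : Matrix α α ℂ) (τ : Matrix β β ℂ) : Matrix α α ℂ →ₗ[ℂ] Matrix β β ℂ :=
  ((Matrix.traceLinearMap α ℂ ℂ).comp (LinearMap.mulLeft ℂ Q)).smulRight τ

@[simp] theorem measurePrepare_apply (Q : Matrix α α ℂ) (τ : Matrix β β ℂ) (X : Matrix α α ℂ) :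
    measurePrepare Q τ X = (Q * X).trace • τ := rfl

theorem posSemidef_trace_mul_block {Q : Matrix α α ℂ} (hQ : Q.PosSemidef) {k : ℕ}
    {X : Matrix (α × Fin k) (α × Fin k) ℂ} (hX : X.PosSemidef) :
    (Matrix.of fun i j : Fin k =>
      (Q * Matrix.of fun a b => X (a, i) (b, j)).trace).PosSemidef := by
  obtain ⟨R, rfl⟩ := CStarAlgebra.nonneg_iff_eq_star_mul_self.mp
    (Matrix.nonneg_iff_posSemidef.mpr hQ)
  -- With `Q = R† R`, `W c` is row `c` of `R` tensored with the identity: a Kraus form of `X ↦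
  -- tr_α[(Q ⊗ 1) X]`.
  let W : α → Matrix (Fin k) (α × Fin k) ℂ := fun c =>
    Matrix.of fun i p => if i = p.2 then R c p.1 else 0
  have h : (Matrix.of fun i j : Fin k =>
      (star R * R * Matrix.of fun a b => X (a, i) (b, j)).trace) = ∑ c, W c * X * (W c)ᴴ := by
    ext i j
    rw [Matrix.of_apply, Matrix.mul_assoc, Matrix.trace_mul_comm, Matrix.sum_apply]
    refine Finset.sum_congr rfl fun c _ => ?_
    simp only [W, Matrix.diag_apply, Matrix.mul_apply, Matrix.of_apply, Matrix.star_apply,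
      Matrix.conjTranspose_apply, Fintype.sum_prod_type, apply_ite star, star_zero, ite_mul,
      zero_mul, mul_ite, mul_zero, Finset.sum_ite_eq, Finset.mem_univ, if_true]
  rw [h]
  exact Matrix.posSemidef_sum _ fun c _ => hX.mul_mul_conjTranspose_same _

theorem isCompletelyPositive_measurePrepare {Q : Matrix α α ℂ} (hQ : Q.PosSemidef)
    {τ : Matrix β β ℂ} (hτ : τ.PosSemidef) : IsCompletelyPositive (measurePrepare Q τ) := by
  intro k X hX
  have h : ampliation (measurePrepare Q τ) k X = Matrix.kroneckerMap (· * ·) τ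
      (Matrix.of fun i j => (Q * Matrix.of fun a b => X (a, i) (b, j)).trace) := by
    ext i j
    simp [ampliation, Matrix.kroneckerMap_apply, mul_comm]
  rw [h]
  exact hτ.kronecker (posSemidef_trace_mul_block hQ hX)

theorem IsCompletelyPositive.add {E F : Matrix α α ℂ →ₗ[ℂ] Matrix β β ℂ}
    (hE : IsCompletelyPositive E) (hF : IsCompletelyPositive F) :
    IsCompletelyPositive (E + F) :=
  fun k X hX => (hE k X hX).add (hF k X hX)

theorem isCPTP_measurePrepare_one (ω : QState β) :
    IsCPTP (measurePrepare (1 : Matrix α α ℂ) ω.mat) :=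
  ⟨isCompletelyPositive_measurePrepare Matrix.PosSemidef.one ω.posSemidef,
    fun X => by simp [ω.trace_eq_one]⟩

/-- A binary measurement followed by the preparation of one of two states is a channel. -/
theorem isCPTP_measurePrepare_add {Q : Matrix α α ℂ} (hQ : Q.PosSemidef)
    (hQ' : (1 - Q).PosSemidef) (τ ω : QState β) :
    IsCPTP (measurePrepare Q τ.mat + measurePrepare (1 - Q) ω.mat) :=
  ⟨(isCompletelyPositive_measurePrepare hQ τ.posSemidef).add
    (isCompletelyPositive_measurePrepare hQ' ω.posSemidef),
    fun X => by simp [τ.trace_eq_one, ω.trace_eq_one, Matrix.sub_mul]⟩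

/-- A state `τ` with `p τ ≤ σ` is a component of weight `p` in a convex decomposition of `σ`. -/
theorem exists_convex_decomposition (τ σ : QState β) {p : ℝ} (hp : p ≤ 1)
    (h : (p : ℂ) • τ.mat ≤ σ.mat) :
    ∃ ω : QState β, (p : ℂ) • τ.mat + (1 - p : ℂ) • ω.mat = σ.mat := by
  rw [Matrix.le_iff] at h
  have htr : (σ.mat - (p : ℂ) • τ.mat).trace = 1 - p := by
    simp [Matrix.trace_sub, σ.trace_eq_one, τ.trace_eq_one]
  rcases hp.eq_or_lt with rfl | hp
  · refine ⟨τ, ?_⟩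
    have h0 := h.trace_eq_zero_iff.mp (by rw [htr]; simp)
    rw [sub_eq_zero] at h0
    rw [h0]
    simp
  · have hne : (1 - p : ℂ) ≠ 0 := by exact_mod_cast (sub_pos.mpr hp).ne'
    refine ⟨⟨(1 - p : ℂ)⁻¹ • (σ.mat - (p : ℂ) • τ.mat), h.smul ?_, ?_⟩, ?_⟩
    · have : (0 : ℝ) ≤ (1 - p)⁻¹ := inv_nonneg.mpr (sub_pos.mpr hp).le
      exact_mod_cast this
    · rw [Matrix.trace_smul, htr, smul_eq_mul, inv_mul_cancel₀ hne]
    · simp [smul_smul, hne]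

/-- If `S_∞(τ'‖σ') < S_0(τ‖σ)`, some channel maps the pair `(τ, σ)` to `(τ', σ')`. -/
theorem exists_isCPTP_of_renyiInfty_lt_renyiZero {τ σ : QState α} {τ' σ' : QState β}
    (h : renyiInfty τ' σ' < renyiZero τ σ) :
    ∃ E : Matrix α α ℂ →ₗ[ℂ] Matrix β β ℂ, IsCPTP E ∧ E τ.mat = τ'.mat ∧ E σ.mat = σ'.mat := by
  set Q := supportProj τ.mat with hQdef
  have hQ : Q.PosSemidef := posSemidef_supportProj _
  have hQ' : (1 - Q).PosSemidef := posSemidef_one_sub_supportProj _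
  set p : ℝ := (Q * σ.mat).trace.re with hpdef
  have hp0 : 0 ≤ p := trace_mul_re_nonneg hQ σ.posSemidef
  have hp1 : p ≤ 1 := by
    have := trace_mul_re_nonneg hQ' σ.posSemidef
    simp only [Matrix.sub_mul, Matrix.one_mul, Matrix.trace_sub, σ.trace_eq_one,
      Complex.sub_re, Complex.one_re] at this
    linarith
  have hpt : (Q * σ.mat).trace = (p : ℂ) := by
    refine Complex.ext rfl ?_
    have hstar : star (Q * σ.mat).trace = (Q * σ.mat).trace := by
      rw [← Matrix.trace_conjTranspose, Matrix.conjTranspose_mul, hQ.isHermitian.eq,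
        σ.posSemidef.isHermitian.eq, Matrix.trace_mul_comm]
    rw [Complex.ofReal_im]
    exact Complex.conj_eq_iff_im.mp hstar
  rw [renyiInfty, renyiZero, ← ENNReal.log_inv, ENNReal.log_lt_log_iff] at h
  simp only [iInf_lt_iff] at h
  obtain ⟨c, hc, hlt⟩ := h
  -- The gap reads `c < 1 / p`; in `ℝ≥0∞` this includes `p = 0`.
  have hpc : p * c ≤ 1 := by
    have h1 : ENNReal.ofReal p * c ≤ 1 := by
      rw [mul_comm]
      exact ENNReal.mul_le_of_le_div (by simpa using hlt.le)
    rwa [← ENNReal.ofReal_coe_nnreal, ← ENNReal.ofReal_mul hp0, ENNReal.ofReal_le_one] at h1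
  have hle : (p : ℂ) • τ'.mat ≤ σ'.mat := by
    rw [Matrix.le_iff] at hc ⊢
    have e : σ'.mat - (p : ℂ) • τ'.mat
        = (p : ℂ) • ((c : ℂ) • σ'.mat - τ'.mat) + ((1 - p * c : ℝ) : ℂ) • σ'.mat := by
      push_cast
      module
    rw [e]
    exact (hc.smul (by exact_mod_cast hp0)).add
      (σ'.posSemidef.smul (by exact_mod_cast sub_nonneg.mpr hpc))
  obtain ⟨ω, hω⟩ := exists_convex_decomposition τ' σ' hp1 hle
  refine ⟨_, isCPTP_measurePrepare_add hQ hQ' τ' ω, ?_, ?_⟩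
  · simp [Matrix.sub_mul, hQdef, supportProj_mul, τ.trace_eq_one]
  · rw [LinearMap.add_apply, measurePrepare_apply, measurePrepare_apply, Matrix.sub_mul,
      Matrix.one_mul, Matrix.trace_sub, hpt, σ.trace_eq_one, hω]

/-- Smoothing is paid for twice: once moving from `ρ` to `τ` before the channel, once from `τ'` to
`ρ'` after it. -/
theorem exists_isCPTP_of_smoothRenyiInfty_lt {ε : ℝ} {ρ σ : QState α} {ρ' σ' : QState β}
    (h : smoothRenyiInfty ε ρ' σ' < smoothRenyiZero ε ρ σ) :
    ∃ E : Matrix α α ℂ →ₗ[ℂ] Matrix β β ℂ, IsCPTP E ∧ E σ.mat = σ'.mat ∧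
      traceDist (E ρ.mat) ρ'.mat ≤ ε + ε := by
  obtain ⟨b, hb', hb⟩ := exists_between h
  simp only [smoothRenyiInfty, smoothRenyiZero, iInf_lt_iff, lt_iSup_iff] at hb hb'
  obtain ⟨τ', hτ', h'⟩ := hb'
  obtain ⟨τ, hτ, h⟩ := hb
  obtain ⟨E, hE, hEτ, hEσ⟩ := exists_isCPTP_of_renyiInfty_lt_renyiZero (h'.trans h)
  refine ⟨E, hE, hEσ, ?_⟩
  calc traceDist (E ρ.mat) ρ'.mat
      ≤ traceDist (E ρ.mat) (E τ.mat) + traceDist (E τ.mat) ρ'.mat :=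
        traceDist_triangle (ρ.map hE).posSemidef.isHermitian (τ.map hE).posSemidef.isHermitian
          ρ'.posSemidef.isHermitian
    _ ≤ ε + ε := by
        refine add_le_add ((hE.traceDist_le ρ.posSemidef.isHermitian
          τ.posSemidef.isHermitian).trans ?_) ?_
        · rw [traceDist_comm]
          exact hτ
        · rw [hEτ]
          exact hτ'

/-! ### Spectral rates and asymptotics -/

theorem upperRateAt_le_upperSpectralRate {d : ℕ} (P Sg : StateSeq d) {ε : ℝ} (hε : 0 < ε) :
    upperRateAt P Sg ε ≤ upperSpectralRate P Sg :=
  ge_of_tendsto (tendsto_upperRateAt P Sg) <| by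
    filter_upwards [Ioo_mem_nhdsGT hε] with δ hδ using antitone_upperRateAt P Sg hδ.2.le

theorem lowerSpectralRate_le_lowerRateAt {d : ℕ} (P Sg : StateSeq d) {ε : ℝ} (hε : 0 < ε) :
    lowerSpectralRate P Sg ≤ lowerRateAt P Sg ε :=
  le_of_tendsto (tendsto_lowerRateAt P Sg) <| by
    filter_upwards [Ioo_mem_nhdsGT hε] with δ hδ using monotone_lowerRateAt P Sg hδ.2.le

/-- The upper spectral divergence rate is monotone under asymptotic d-majorization. -/
theorem AsympDMajorizedBy.upperSpectralRate_le {d : ℕ} {P Sg P' Sg' : StateSeq d}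
    (h : AsympDMajorizedBy P' Sg' P Sg) :
    upperSpectralRate P' Sg' ≤ upperSpectralRate P Sg := by
  obtain ⟨E, hE, hlim, hSg⟩ := h
  refine le_of_tendsto (tendsto_upperRateAt P' Sg') ?_
  filter_upwards [self_mem_nhdsWithin] with δ (hδ : 0 < δ)
  -- Half of `δ` is the smoothing radius before the channel, the other half absorbs its error.
  refine le_trans ?_ (upperRateAt_le_upperSpectralRate P Sg (half_pos hδ))
  refine limsup_le_limsup ?_
  filter_upwards [hlim.eventually_le_const (half_pos hδ)] with n hn
  refine EReal.monotone_div_right_of_nonneg (by positivity) ?_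
  have key := smoothRenyiInfty_map_le (hE n) (P n) (Sg n) (P' n) (ε := δ / 2) hn
  have hmap : (Sg n).map (hE n) = Sg' n := by
    cases h' : Sg' n with
    | mk m _ _ =>
      have := hSg n
      rw [h'] at this
      simp only [QState.map, this]
  rwa [add_halves, hmap] at key

/-- A gap between the spectral divergence rates yields asymptotic d-majorization. -/
theorem asympDMajorizedBy_of_lt {d : ℕ} {P Sg P' Sg' : StateSeq d}
    (h : upperSpectralRate P' Sg' < lowerSpectralRate P Sg) : AsympDMajorizedBy P' Sg' P Sg := by
  obtain ⟨a, ha', ha⟩ := exists_between h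
  have hev : ∀ ε : ℝ, 0 < ε → ∀ᶠ n in atTop,
      ∃ E : Matrix (TensorIndex d n) (TensorIndex d n) ℂ →ₗ[ℂ]
        Matrix (TensorIndex d n) (TensorIndex d n) ℂ,
      IsCPTP E ∧ E (Sg n).mat = (Sg' n).mat ∧
        traceDist (E (P n).mat) (P' n).mat ≤ ε + ε := by
    intro ε hε
    have h1 := eventually_lt_of_limsup_lt
      ((upperRateAt_le_upperSpectralRate P' Sg' hε).trans_lt ha')
    have h2 := eventually_lt_of_lt_liminf
      (ha.trans_le (lowerSpectralRate_le_lowerRateAt P Sg hε))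
    filter_upwards [h1, h2] with n hn1 hn2
    refine exists_isCPTP_of_smoothRenyiInfty_lt (lt_of_not_ge fun hle => ?_)
    exact (hn1.trans hn2).not_ge (EReal.monotone_div_right_of_nonneg (by positivity) hle)
  -- For every `n`, the distances attained by the admissible channels.
  let T : ℕ → Set ℝ := fun n => {r | ∃ E : Matrix (TensorIndex d n) (TensorIndex d n) ℂ →ₗ[ℂ]
    Matrix (TensorIndex d n) (TensorIndex d n) ℂ,
    IsCPTP E ∧ E (Sg n).mat = (Sg' n).mat ∧ traceDist (E (P n).mat) (P' n).mat = r}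
  have hne : ∀ n, (T n).Nonempty := fun n =>
    -- Discarding the input and preparing `σ'_n` is always admissible, so small `n` need no separate
    -- choice.
    ⟨_, _, isCPTP_measurePrepare_one (Sg' n), by simp [(Sg n).trace_eq_one], rfl⟩
  have hbdd : ∀ n, BddBelow (T n) := by
    refine fun n => ⟨0, ?_⟩
    rintro _ ⟨E, _, _, rfl⟩
    exact traceDist_nonneg _ _
  -- The slack `1 / (n + 1)` replaces attainment of the infimum.
  have hnear : ∀ n, ∃ r ∈ T n, r < sInf (T n) + 1 / ((n : ℝ) + 1) := fun n =>
    exists_lt_of_csInf_lt (hne n) (lt_add_of_pos_right _ Nat.one_div_pos_of_nat)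
  choose r hrT hr using hnear
  choose E hE hSg hdist using hrT
  refine ⟨E, hE, ?_, hSg⟩
  simp only [hdist]
  refine Metric.tendsto_atTop'.mpr fun δ hδ => ?_
  -- The budget is `2 · δ/4` for smoothing plus `δ/2` for the slack.
  obtain ⟨N, hN⟩ := eventually_atTop.mp ((hev (δ / 4) (by positivity)).and
    (tendsto_one_div_add_atTop_nhds_zero_nat.eventually_lt_const (half_pos hδ)))
  refine ⟨N, fun n hn => ?_⟩
  obtain ⟨⟨F, hF, hFS, hFd⟩, hsmall⟩ := hN n hn.le
  have h1 : sInf (T n) ≤ δ / 4 + δ / 4 := (csInf_le (hbdd n) ⟨F, hF, hFS, rfl⟩).trans hFd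
  have h0 : 0 ≤ r n := hdist n ▸ traceDist_nonneg _ _
  rw [Real.dist_eq, sub_zero, abs_of_nonneg h0]
  linarith [hr n]

end Quantum

theorem mainTheorem5 {d : ℕ} (P Sg P' Sg' : StateSeq d) (S S' : EReal)
    (hupper : Quantum.upperSpectralRate P Sg = S)
    (hlower : Quantum.lowerSpectralRate P Sg = S)
    (hupper' : Quantum.upperSpectralRate P' Sg' = S')
    (hlower' : Quantum.lowerSpectralRate P' Sg' = S') :
    (Quantum.AsympDMajorizedBy P' Sg' P Sg → S' ≤ S) ∧
    (S' < S → Quantum.AsympDMajorizedBy P' Sg' P Sg) := by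
  refine ⟨fun h => ?_, fun h => ?_⟩
  · rw [← hupper, ← hupper']
    exact h.upperSpectralRate_le
  · rw [← hlower, ← hupper'] at h
    exact Quantum.asympDMajorizedBy_of_lt h
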